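/- Let $d\ge 1$, let $\|\cdot\|$ be the Euclidean norm on $\mathbb{R}^d$ and $\|M\|=\bigl(\sum_{i,j}|M_{i,j}|^2\bigr)^{1/2}$ on $\mathcal{M}_d(\mathbb{R})$. Let $\mu>0$ and let $F:\mathbb{R}^d\to\mathbb{R}$ be of class $\mathcal{C}^3$ such that $\nabla F$ is globally Lipschitz continuous, $\langle\nabla F(x_2)-\nabla F(x_1),x_2-x_1\rangle\ge\mu\|x_2-x_1\|^2$ for all $x_1,x_2\in\mathbb{R}^d$, and the third order derivative of $F$ is bounded. Let $x^\star$ be the unique minimizer of $F$. Let $\sigma:[0,\infty)\times\mathbb{R}^d\to\mathcal{M}_d(\mathbb{R})$ be continuous, and assume that there is a bounded function $\varsigma:[0,\infty)\to[0,\infty)$ such that for all $t\ge 0$ one has $\|\sigma(t,x_2)-\sigma(t,x_1)\|\le\varsigma(t)\|x_2-x_1\|$ for all $x_1,x_2\in\mathbb{R}^d$ and $\sup_{x\in\mathbb{R}^d}\frac{\|\sigma(t,x)\|}{1+\|x-x^\star\|}\le\varsigma(t)$. Let $h_{\max}>0$. Let $(\gamma_n)_{n\ge 1}$ be a sequence of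 independent standard Gaussian random vectors in $\mathbb{R}^d$, and for $x_0\in\mathbb{R}^d$ and $h\in(0,h_{\max})$ set \[ X_0=x_0,\qquad X_{n+1}=X_n-h\nabla F(X_n)+h\,\sigma(nh,X_n)\gamma_{n+1},\quad n\ge 0. \] There exist $H\in(0,h_{\max})$ and $C\in(0,\infty)$, independent of $x_0$, $N$ and $h$, such that for all $x_0\in\mathbb{R}^d$, all integers $N\ge 1$ and all $h\in(0,H)$, the random variables $F(X_N)-F(x^\star)$ and $\|X_N-x^\star\|^2$ are integrable, and \[ \mathbb{E}[F(X_N)-F(x^\star)]\le C\bigl(1+\|x_0-x^\star\|^3\bigr)\bigl(e^{-\mu Nh}+h\bigr), \] \[ \mathbb{E}[\|X_N-x^\star\|]\le\bigl(\mathbb{E}[\|X_N-x^\star\|^2]\bigr)^{\frac12}\le C\bigl(1+\|x_0-x^\star\|^{\frac32}\bigr)\bigl(e^{-\frac{\mu Nh}{2}}+h^{\frac12}\bigr). \] -/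

import Mathlib

open MeasureTheory ProbabilityTheory
open scoped RealInnerProductSpace Gradient

/-- The Frobenius norm of a real matrix. -/
noncomputable def frobNorm {d : ℕ} (M : Matrix (Fin d) (Fin d) ℝ) : ℝ :=
  Real.sqrt (∑ i, ∑ j, (M i j) ^ 2)

/-- Basic assumptions on the objective function: class `C³`, globally Lipschitz gradient,
`μ`-convexity with `μ > 0`, bounded third order derivative. -/
structure BasicObjective {d : ℕ} (F : EuclideanSpace ℝ (Fin d) → ℝ) (μ : ℝ) : Prop where
  contDiff : ContDiff ℝ 3 F
  lipschitz_gradient : ∃ L : ℝ, 0 < L ∧ ∀ x₁ x₂, ‖∇ F x₂ - ∇ F x₁‖ ≤ L * ‖x₂ - x₁‖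
  mu_pos : 0 < μ
  mu_convex : ∀ x₁ x₂, μ * ‖x₂ - x₁‖ ^ 2 ≤ ⟪∇ F x₂ - ∇ F x₁, x₂ - x₁⟫
  bounded_third : ∃ M : ℝ, ∀ x, ‖iteratedFDeriv ℝ 3 F x‖ ≤ M

/-- A global minimizer of `F`; under the basic assumptions it exists and is unique
(see `BasicObjective.eq_minimizer_iff`). -/
noncomputable def minimizer {d : ℕ} (F : EuclideanSpace ℝ (Fin d) → ℝ) :
    EuclideanSpace ℝ (Fin d) :=
  Classical.epsilon fun x => ∀ y, F x ≤ F y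

/-- Basic assumptions on the diffusion coefficient `σ : [0,∞) × ℝᵈ → M_d(ℝ)`, with linear growth
measured from the point `xs`. Only the values of `σ` and `ς` at nonnegative times matter. -/
structure BasicDiffusion {d : ℕ} (σ : ℝ → EuclideanSpace ℝ (Fin d) → Matrix (Fin d) (Fin d) ℝ)
    (xs : EuclideanSpace ℝ (Fin d)) : Prop where
  continuousOn : ContinuousOn (fun p : ℝ × EuclideanSpace ℝ (Fin d) => σ p.1 p.2)
    (Set.Ici (0 : ℝ) ×ˢ Set.univ)
  lipschitz_growth : ∃ ς : ℝ → ℝ,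
    (∀ t, 0 ≤ t → 0 ≤ ς t) ∧
    (∀ t, 0 ≤ t → ∀ x₁ x₂, frobNorm (σ t x₂ - σ t x₁) ≤ ς t * ‖x₂ - x₁‖) ∧
    (∀ t, 0 ≤ t → ∀ x, frobNorm (σ t x) / (1 + ‖x - xs‖) ≤ ς t) ∧
    (∃ K : ℝ, ∀ t, 0 ≤ t → ς t ≤ K)

/-- The sequence `γ 1, γ 2, …` consists of independent standard Gaussian random vectors of `ℝᵈ`
(the term `γ 0` is unused). -/
structure IsGaussianNoise {d : ℕ} {Ω : Type*} [MeasurableSpace Ω] (P : Measure Ω)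
    (γ : ℕ → Ω → EuclideanSpace ℝ (Fin d)) : Prop where
  hasLaw : ∀ n, HasLaw (γ (n + 1)) (stdGaussian (EuclideanSpace ℝ (Fin d))) P
  indep : iIndepFun (fun n : ℕ => γ (n + 1)) P

/-- The stochastic gradient scheme
`X_{n+1} = X_n - h ∇F(X_n) + h σ(n h, X_n) γ_{n+1}`, `X_0 = x₀`. -/
noncomputable def sgScheme {d : ℕ} {Ω : Type*} (F : EuclideanSpace ℝ (Fin d) → ℝ)
    (σ : ℝ → EuclideanSpace ℝ (Fin d) → Matrix (Fin d) (Fin d) ℝ)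
    (h : ℝ) (x₀ : EuclideanSpace ℝ (Fin d)) (γ : ℕ → Ω → EuclideanSpace ℝ (Fin d)) :
    ℕ → Ω → EuclideanSpace ℝ (Fin d)
  | 0, _ => x₀
  | n + 1, ω =>
    sgScheme F σ h x₀ γ n ω - h • ∇ F (sgScheme F σ h x₀ γ n ω)
      + h • WithLp.toLp 2 (Matrix.mulVec (σ (n * h) (sgScheme F σ h x₀ γ n ω)) (γ (n + 1) ω))

/-- If the gradient pairs nonnegatively with `v` along a segment of direction `v`, then `F` does
not decrease from one end to the other. -/
theorem le_add_of_inner_gradient_nonneg {d : ℕ} {F : EuclideanSpace ℝ (Fin d) → ℝ}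
    (hF : Differentiable ℝ F) (x v : EuclideanSpace ℝ (Fin d))
    (h : ∀ t : ℝ, 0 < t → t < 1 → 0 ≤ ⟪∇ F (x + t • v), v⟫) : F x ≤ F (x + v) := by
  have hd : ∀ t : ℝ, HasDerivAt (fun s : ℝ => F (x + s • v)) ⟪∇ F (x + t • v), v⟫ t := by
    intro t
    have h1 : HasDerivAt (fun s : ℝ => x + s • v) v t := by
      simpa using ((hasDerivAt_id t).smul_const v).const_add x
    have h2 := (hF (x + t • v)).hasFDerivAt.comp_hasDerivAt t h1
    rwa [← inner_gradient_left] at h2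
  have hm : MonotoneOn (fun s : ℝ => F (x + s • v)) (Set.Icc 0 1) := by
    refine monotoneOn_of_deriv_nonneg (convex_Icc 0 1)
      (fun t _ => (hd t).continuousAt.continuousWithinAt)
      (fun t _ => (hd t).differentiableAt.differentiableWithinAt) ?_
    intro t ht
    rw [interior_Icc] at ht
    rw [(hd t).deriv]
    exact h t ht.1 ht.2
  simpa using hm (Set.left_mem_Icc.2 zero_le_one) (Set.right_mem_Icc.2 zero_le_one) zero_le_one

/-- Existence of a global minimizer. -/
theorem BasicObjective.exists_minimizer {d : ℕ} {F : EuclideanSpace ℝ (Fin d) → ℝ} {μ : ℝ}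
    (hF : BasicObjective F μ) : ∃ x, ∀ y, F x ≤ F y := by
  have hdiff : Differentiable ℝ F := hF.contDiff.differentiable (by norm_num)
  set R : ℝ := ‖∇ F 0‖ / μ with hR
  have hR0 : 0 ≤ R := div_nonneg (norm_nonneg _) hF.mu_pos.le
  obtain ⟨x, hx, hmin⟩ := (isCompact_closedBall (0 : EuclideanSpace ℝ (Fin d)) R).exists_isMinOn
    ⟨0, by simpa using hR0⟩ hdiff.continuous.continuousOn
  refine ⟨x, fun y => ?_⟩
  by_cases hy : ‖y‖ ≤ R
  · exact hmin (by simpa using hy)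
  · have hyR : R < ‖y‖ := not_lt.1 (fun h => hy h.le) |>.lt_of_ne (fun h => hy h.symm.le)
    have hy0 : 0 < ‖y‖ := hR0.trans_lt hyR
    have hz : ‖(R / ‖y‖) • y‖ ≤ R := by
      rw [norm_smul, Real.norm_of_nonneg (by positivity), div_mul_cancel₀ _ hy0.ne']
    refine (hmin (by simpa using hz) : F x ≤ F ((R / ‖y‖) • y)).trans ?_
    have hc : 0 < 1 - R / ‖y‖ := by
      rw [sub_pos, div_lt_one hy0]; exact hyR
    have key := le_add_of_inner_gradient_nonneg hdiff ((R / ‖y‖) • y) ((1 - R / ‖y‖) • y) ?_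
    · rwa [← add_smul, add_sub_cancel, one_smul] at key
    · intro t ht0 _
      rw [smul_smul, ← add_smul, inner_smul_right]
      refine mul_nonneg hc.le ?_
      set s : ℝ := R / ‖y‖ + t * (1 - R / ‖y‖) with hs
      have hs1 : R / ‖y‖ < s := by
        rw [hs]; have := mul_pos ht0 hc; linarith
      have hs0 : 0 < s := lt_of_le_of_lt (by positivity) hs1
      have hsR : R ≤ s * ‖y‖ := ((div_lt_iff₀ hy0).1 hs1).le
      have hμR : ‖∇ F 0‖ ≤ μ * (s * ‖y‖) := by
        have : ‖∇ F 0‖ = μ * R := by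
          rw [hR, mul_div_cancel₀ _ hF.mu_pos.ne']
        rw [this]
        exact mul_le_mul_of_nonneg_left hsR hF.mu_pos.le
      have h1 := hF.mu_convex 0 (s • y)
      rw [sub_zero, norm_smul, Real.norm_of_nonneg hs0.le, inner_sub_left, inner_smul_right,
        inner_smul_right] at h1
      have h2 : -(‖∇ F 0‖ * ‖y‖) ≤ ⟪∇ F 0, y⟫ := neg_le_of_abs_le (abs_real_inner_le_norm _ _)
      have h3 : ‖∇ F 0‖ * ‖y‖ ≤ μ * (s * ‖y‖) * ‖y‖ := mul_le_mul_of_nonneg_right hμR hy0.le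
      have h4 : 0 ≤ s * ⟪∇ F (s • y), y⟫ := by nlinarith
      exact nonneg_of_mul_nonneg_right h4 hs0

/-- The gradient vanishes at a global minimizer. -/
theorem gradient_eq_zero_of_forall_le {d : ℕ} {F : EuclideanSpace ℝ (Fin d) → ℝ}
    {x : EuclideanSpace ℝ (Fin d)} (hx : ∀ y, F x ≤ F y) : ∇ F x = 0 := by
  have : IsLocalMin F x := Filter.Eventually.of_forall hx
  rw [gradient, this.fderiv_eq_zero, map_zero]

/-- Under the basic assumptions, `minimizer F` is the unique global minimizer of `F`. -/
theorem BasicObjective.eq_minimizer_iff {d : ℕ} {F : EuclideanSpace ℝ (Fin d) → ℝ} {μ : ℝ}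
    (hF : BasicObjective F μ) (x : EuclideanSpace ℝ (Fin d)) :
    x = minimizer F ↔ ∀ y, F x ≤ F y := by
  have h0 : ∀ y, F (minimizer F) ≤ F y := Classical.epsilon_spec hF.exists_minimizer
  refine ⟨fun h => h ▸ h0, fun h => ?_⟩
  have h1 := hF.mu_convex (minimizer F) x
  rw [gradient_eq_zero_of_forall_le h, gradient_eq_zero_of_forall_le h0, sub_zero,
    inner_zero_left] at h1
  have h2 : ‖x - minimizer F‖ ^ 2 = 0 :=
    le_antisymm (nonpos_of_mul_nonpos_right h1 hF.mu_pos) (sq_nonneg _)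
  exact sub_eq_zero.1 (norm_eq_zero.1 (pow_eq_zero_iff (two_ne_zero) |>.1 h2))

/-! The excess φ = F - F(x⋆) is a Lyapunov function for the scheme. The Lipschitz gradient bounds F
after one step by its second-order expansion. Averaging over the Gaussian increment, independent of
the current iterate, kills the linear noise term and leaves (L/2) h² ‖σ‖². The Polyak–Łojasiewicz
inequality turns the gradient term into a decrease of φ. Linear growth of σ and quadratic growth of
F bound ‖σ‖² by an affine function of φ, whose slope is absorbed in the decrease for small h.

The result is E φ(X_{n+1}) ≤ (1 - μh) E φ(X_n) + L K² h² (`lintegral_step_le_contraction`).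
Iterating, the error terms sum to at most L K² h / μ, and (1 - μh)^N ≤ exp(-μNh). Quadratic growth
then transfers the rate to the mean square distance. The recursion is run on Lebesgue integrals of
the nonnegative excess, so integrability comes out of the final bound. -/

/-! ### Consequences of smoothness and strong convexity -/

/-- Along a segment, this yields the upper quadratic bound with c = L‖v‖² and, applied to -F, the
lower one with c = -μ‖v‖². -/
theorem le_of_hasDerivAt_sub_le {φ φ' : ℝ → ℝ} {c : ℝ} (hφ : ∀ t, HasDerivAt φ (φ' t) t)
    (h : ∀ t, 0 < t → t < 1 → φ' t - φ' 0 ≤ t * c) : φ 1 ≤ φ 0 + φ' 0 + c / 2 := by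
  have hd : ∀ t, HasDerivAt (fun s => s * φ' 0 + s ^ 2 * (c / 2) - φ s)
      (φ' 0 + t * c - φ' t) t := by
    intro t
    have h1 := (((hasDerivAt_id t).mul_const (φ' 0)).add
      (((hasDerivAt_id t).pow 2).mul_const (c / 2))).sub (hφ t)
    refine h1.congr_deriv ?_
    simp
    ring
  have hm : MonotoneOn (fun s => s * φ' 0 + s ^ 2 * (c / 2) - φ s) (Set.Icc 0 1) := by
    refine monotoneOn_of_deriv_nonneg (convex_Icc 0 1)
      (fun t _ => (hd t).continuousAt.continuousWithinAt)
      (fun t _ => (hd t).differentiableAt.differentiableWithinAt) ?_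
    intro t ht
    rw [interior_Icc] at ht
    rw [(hd t).deriv]
    linarith [h t ht.1 ht.2]
  have := hm (Set.left_mem_Icc.2 zero_le_one) (Set.right_mem_Icc.2 zero_le_one) zero_le_one
  norm_num at this
  linarith

theorem hasDerivAt_comp_line {d : ℕ} {F : EuclideanSpace ℝ (Fin d) → ℝ}
    (hF : Differentiable ℝ F) (x v : EuclideanSpace ℝ (Fin d)) (t : ℝ) :
    HasDerivAt (fun s : ℝ => F (x + s • v)) ⟪∇ F (x + t • v), v⟫ t := by
  have h1 : HasDerivAt (fun s : ℝ => x + s • v) v t := by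
    simpa using ((hasDerivAt_id t).smul_const v).const_add x
  have h2 := (hF (x + t • v)).hasFDerivAt.comp_hasDerivAt t h1
  rwa [← inner_gradient_left] at h2

namespace BasicObjective

variable {d : ℕ} {F : EuclideanSpace ℝ (Fin d) → ℝ} {μ : ℝ}

theorem differentiable (hF : BasicObjective F μ) : Differentiable ℝ F :=
  hF.contDiff.differentiable (by norm_num)

theorem continuous_gradient (hF : BasicObjective F μ) : Continuous (∇ F) :=
  (InnerProductSpace.toDual ℝ (EuclideanSpace ℝ (Fin d))).symm.continuous.comp
    (hF.contDiff.continuous_fderiv (by norm_num))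

theorem minimizer_le (hF : BasicObjective F μ) (y : EuclideanSpace ℝ (Fin d)) :
    F (minimizer F) ≤ F y :=
  (hF.eq_minimizer_iff _).1 rfl y

theorem gradient_minimizer (hF : BasicObjective F μ) : ∇ F (minimizer F) = 0 :=
  gradient_eq_zero_of_forall_le hF.minimizer_le

theorem descent (hF : BasicObjective F μ) {L : ℝ}
    (hL : ∀ x₁ x₂, ‖∇ F x₂ - ∇ F x₁‖ ≤ L * ‖x₂ - x₁‖) (x v : EuclideanSpace ℝ (Fin d)) :
    F (x + v) ≤ F x + ⟪∇ F x, v⟫ + L / 2 * ‖v‖ ^ 2 := by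
  have := le_of_hasDerivAt_sub_le (c := L * ‖v‖ ^ 2) (hasDerivAt_comp_line hF.differentiable x v)
    fun t ht _ => by
      have h1 := hL x (x + t • v)
      rw [add_sub_cancel_left, norm_smul, Real.norm_of_nonneg ht.le] at h1
      rw [zero_smul, add_zero, ← inner_sub_left]
      calc _ ≤ ‖∇ F (x + t • v) - ∇ F x‖ * ‖v‖ := real_inner_le_norm _ _
        _ ≤ L * (t * ‖v‖) * ‖v‖ := by gcongr
        _ = _ := by ring
  simp only [one_smul, zero_smul, add_zero] at this
  linarith

theorem strong_convexity (hF : BasicObjective F μ) (x v : EuclideanSpace ℝ (Fin d)) :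
    F x + ⟪∇ F x, v⟫ + μ / 2 * ‖v‖ ^ 2 ≤ F (x + v) := by
  have := le_of_hasDerivAt_sub_le (c := -(μ * ‖v‖ ^ 2))
    (fun t => (hasDerivAt_comp_line hF.differentiable x v t).neg)
    fun t ht _ => by
      have h1 := hF.mu_convex x (x + t • v)
      rw [add_sub_cancel_left, norm_smul, Real.norm_of_nonneg ht.le, inner_smul_right,
        inner_sub_left] at h1
      rw [zero_smul, add_zero]
      -- Monotonicity is tested against t • v, so both sides carry a spare factor t > 0, which is
      -- cancelled.
      have h2 : t * (μ * t * ‖v‖ ^ 2) ≤ t * (⟪∇ F (x + t • v), v⟫ - ⟪∇ F x, v⟫) := by linarith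
      linarith [le_of_mul_le_mul_left h2 ht]
  simp only [one_smul, zero_smul, add_zero, Pi.neg_apply] at this
  linarith

/-- Strong convexity from x towards the minimizer and Cauchy–Schwarz bound the excess by ‖∇F x‖ s -
(μ/2) s², with s the distance; completing the square removes s. -/
theorem polyak_lojasiewicz (hF : BasicObjective F μ) (x : EuclideanSpace ℝ (Fin d)) :
    2 * μ * (F x - F (minimizer F)) ≤ ‖∇ F x‖ ^ 2 := by
  have h1 := hF.strong_convexity x (minimizer F - x)
  rw [add_sub_cancel] at h1
  have h2 := neg_le_of_abs_le (abs_real_inner_le_norm (∇ F x) (minimizer F - x))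
  have h3 := sq_nonneg (‖∇ F x‖ - μ * ‖minimizer F - x‖)
  have h4 : μ * (F x - F (minimizer F)) ≤
      μ * (‖∇ F x‖ * ‖minimizer F - x‖ - μ / 2 * ‖minimizer F - x‖ ^ 2) :=
    mul_le_mul_of_nonneg_left (by linarith) hF.mu_pos.le
  linarith

theorem quadratic_growth (hF : BasicObjective F μ) (x : EuclideanSpace ℝ (Fin d)) :
    ‖x - minimizer F‖ ^ 2 ≤ 2 / μ * (F x - F (minimizer F)) := by
  have h1 := hF.strong_convexity (minimizer F) (x - minimizer F)
  rw [add_sub_cancel, hF.gradient_minimizer, inner_zero_left] at h1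
  rw [div_mul_eq_mul_div, le_div_iff₀ hF.mu_pos]
  linarith

theorem sub_le_quadratic (hF : BasicObjective F μ) {L : ℝ}
    (hL : ∀ x₁ x₂, ‖∇ F x₂ - ∇ F x₁‖ ≤ L * ‖x₂ - x₁‖) (x : EuclideanSpace ℝ (Fin d)) :
    F x - F (minimizer F) ≤ L / 2 * ‖x - minimizer F‖ ^ 2 := by
  have h1 := hF.descent hL (minimizer F) (x - minimizer F)
  rw [add_sub_cancel, hF.gradient_minimizer, inner_zero_left] at h1
  linarith

end BasicObjective

/-! ### Gaussian moments of linear and quadratic forms -/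

theorem integrable_inner_stdGaussian {d : ℕ} (v : EuclideanSpace ℝ (Fin d)) :
    Integrable (fun g => ⟪v, g⟫) (stdGaussian (EuclideanSpace ℝ (Fin d))) :=
  (innerSL ℝ v).integrable_comp IsGaussian.integrable_fun_id

theorem memLp_inner_stdGaussian {d : ℕ} (v : EuclideanSpace ℝ (Fin d)) :
    MemLp (fun g => ⟪v, g⟫) 2 (stdGaussian (EuclideanSpace ℝ (Fin d))) :=
  (innerSL ℝ v).comp_memLp' IsGaussian.memLp_two_id

theorem integral_inner_stdGaussian {d : ℕ} (v : EuclideanSpace ℝ (Fin d)) :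
    ∫ g, ⟪v, g⟫ ∂stdGaussian (EuclideanSpace ℝ (Fin d)) = 0 :=
  integral_strongDual_stdGaussian (innerSL ℝ v)

theorem integral_inner_sq_stdGaussian {d : ℕ} (v : EuclideanSpace ℝ (Fin d)) :
    ∫ g, ⟪v, g⟫ ^ 2 ∂stdGaussian (EuclideanSpace ℝ (Fin d)) = ‖v‖ ^ 2 := by
  have h1 := variance_dual_stdGaussian (innerSL ℝ v)
  rw [variance_of_integral_eq_zero (innerSL ℝ v).continuous.aemeasurable
    (integral_strongDual_stdGaussian _), innerSL_apply_norm] at h1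
  exact h1

theorem inner_toLp_mulVec {d : ℕ} (A : Matrix (Fin d) (Fin d) ℝ)
    (v g : EuclideanSpace ℝ (Fin d)) :
    ⟪v, WithLp.toLp 2 (A.mulVec g)⟫ = ⟪WithLp.toLp 2 (A.transpose.mulVec v), g⟫ := by
  simp only [EuclideanSpace.inner_eq_star_dotProduct, star_trivial]
  rw [Matrix.mulVec_transpose, dotProduct_comm, Matrix.dotProduct_mulVec, dotProduct_comm]

theorem norm_sq_toLp_mulVec {d : ℕ} (A : Matrix (Fin d) (Fin d) ℝ)
    (g : EuclideanSpace ℝ (Fin d)) :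
    ‖WithLp.toLp 2 (A.mulVec g)‖ ^ 2 = ∑ i, ⟪WithLp.toLp 2 (A i), g⟫ ^ 2 := by
  rw [EuclideanSpace.real_norm_sq_eq]
  refine Finset.sum_congr rfl fun i _ => ?_
  simp only [EuclideanSpace.inner_eq_star_dotProduct, star_trivial]
  rw [dotProduct_comm]
  rfl

theorem frobNorm_sq {d : ℕ} (A : Matrix (Fin d) (Fin d) ℝ) :
    frobNorm A ^ 2 = ∑ i, ‖WithLp.toLp 2 (A i)‖ ^ 2 := by
  rw [frobNorm, Real.sq_sqrt (by positivity)]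
  simp [EuclideanSpace.real_norm_sq_eq]

theorem integrable_norm_sq_toLp_mulVec_stdGaussian {d : ℕ} (A : Matrix (Fin d) (Fin d) ℝ) :
    Integrable (fun g : EuclideanSpace ℝ (Fin d) => ‖WithLp.toLp 2 (A.mulVec g)‖ ^ 2)
      (stdGaussian (EuclideanSpace ℝ (Fin d))) := by
  simp_rw [norm_sq_toLp_mulVec]
  exact integrable_finsetSum _ fun i _ => (memLp_inner_stdGaussian _).integrable_sq

theorem integral_norm_sq_toLp_mulVec_stdGaussian {d : ℕ} (A : Matrix (Fin d) (Fin d) ℝ) :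
    ∫ g : EuclideanSpace ℝ (Fin d), ‖WithLp.toLp 2 (A.mulVec g)‖ ^ 2 ∂stdGaussian (EuclideanSpace ℝ (Fin d)) =
      frobNorm A ^ 2 := by
  simp_rw [norm_sq_toLp_mulVec]
  rw [integral_finsetSum _ fun i _ => (memLp_inner_stdGaussian _).integrable_sq, frobNorm_sq]
  exact Finset.sum_congr rfl fun i _ => integral_inner_sq_stdGaussian _

/-! ### One step of the scheme -/

/-- Expected decrease of the objective in a single noisy gradient step. -/
theorem BasicObjective.lintegral_step_le {d : ℕ} {F : EuclideanSpace ℝ (Fin d) → ℝ} {μ : ℝ}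
    (hF : BasicObjective F μ) {L : ℝ}
    (hL : ∀ x₁ x₂, ‖∇ F x₂ - ∇ F x₁‖ ≤ L * ‖x₂ - x₁‖) (A : Matrix (Fin d) (Fin d) ℝ)
    (h : ℝ) (x : EuclideanSpace ℝ (Fin d)) :
    ∫⁻ g : EuclideanSpace ℝ (Fin d), ENNReal.ofReal (F (x - h • ∇ F x + h • WithLp.toLp 2 (A.mulVec g)) - F (minimizer F))
        ∂stdGaussian (EuclideanSpace ℝ (Fin d)) ≤
      ENNReal.ofReal (F x - F (minimizer F) - h * (1 - L * h / 2) * ‖∇ F x‖ ^ 2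
        + L / 2 * h ^ 2 * frobNorm A ^ 2) := by
  -- Integrable majorant from the descent inequality. The coefficient h - L h² joins the first-order
  -- noise term and the cross term of the square; its value is irrelevant, since that term has mean
  -- zero.
  set b : EuclideanSpace ℝ (Fin d) → ℝ := fun g =>
    (F x - F (minimizer F) - h * (1 - L * h / 2) * ‖∇ F x‖ ^ 2)
      + (h - L * h ^ 2) * ⟪WithLp.toLp 2 (A.transpose.mulVec (∇ F x).ofLp), g⟫
      + L / 2 * h ^ 2 * ‖WithLp.toLp 2 (A.mulVec g)‖ ^ 2 with hb
  have hle : ∀ g : EuclideanSpace ℝ (Fin d),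
      F (x - h • ∇ F x + h • WithLp.toLp 2 (A.mulVec g)) - F (minimizer F) ≤ b g := by
    intro g
    have h1 := hF.descent hL x (h • WithLp.toLp 2 (A.mulVec g) - h • ∇ F x)
    rw [show x + (h • WithLp.toLp 2 (A.mulVec g) - h • ∇ F x) =
        x - h • ∇ F x + h • WithLp.toLp 2 (A.mulVec g) by abel, norm_sub_sq_real, norm_smul,
      norm_smul, inner_sub_right, inner_smul_right, inner_smul_right, inner_smul_left,
      inner_smul_right, real_inner_self_eq_norm_sq, mul_pow, mul_pow, Real.norm_eq_abs, sq_abs,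
      real_inner_comm (∇ F x), inner_toLp_mulVec] at h1
    simp only [hb, conj_trivial] at h1 ⊢
    nlinarith
  have hi1 := (integrable_inner_stdGaussian
    (WithLp.toLp 2 (A.transpose.mulVec (∇ F x).ofLp))).const_mul (h - L * h ^ 2)
  have hi2 := (integrable_norm_sq_toLp_mulVec_stdGaussian A).const_mul (L / 2 * h ^ 2)
  have hi0 := integrable_const (μ := stdGaussian (EuclideanSpace ℝ (Fin d)))
    (F x - F (minimizer F) - h * (1 - L * h / 2) * ‖∇ F x‖ ^ 2)
  have hi01 : Integrable (fun g =>
      (F x - F (minimizer F) - h * (1 - L * h / 2) * ‖∇ F x‖ ^ 2)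
        + (h - L * h ^ 2) * ⟪WithLp.toLp 2 (A.transpose.mulVec (∇ F x).ofLp), g⟫)
      (stdGaussian (EuclideanSpace ℝ (Fin d))) := hi0.add hi1
  have hbi : Integrable b (stdGaussian (EuclideanSpace ℝ (Fin d))) := hi01.add hi2
  have hbint : ∫ g, b g ∂stdGaussian (EuclideanSpace ℝ (Fin d)) =
      F x - F (minimizer F) - h * (1 - L * h / 2) * ‖∇ F x‖ ^ 2
        + L / 2 * h ^ 2 * frobNorm A ^ 2 := by
    simp only [hb]
    rw [integral_add hi01 hi2, integral_add hi0 hi1, integral_const_mul,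
      integral_const_mul, integral_inner_stdGaussian, integral_norm_sq_toLp_mulVec_stdGaussian]
    simp
  -- The majorant is nonnegative because it dominates the excess, so its two integrals agree.
  rw [← hbint, ofReal_integral_eq_lintegral_ofReal hbi (Filter.Eventually.of_forall fun g =>
    (sub_nonneg.2 (hF.minimizer_le _)).trans (hle g))]
  exact lintegral_mono fun g => ENNReal.ofReal_le_ofReal (hle g)

/-- Contraction, up to `O(h²)`, of the expected excess in one step of small enough size. -/
theorem BasicObjective.lintegral_step_le_contraction {d : ℕ} {F : EuclideanSpace ℝ (Fin d) → ℝ}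
    {μ : ℝ} (hF : BasicObjective F μ) {L : ℝ} (hL0 : 0 < L)
    (hL : ∀ x₁ x₂, ‖∇ F x₂ - ∇ F x₁‖ ≤ L * ‖x₂ - x₁‖) {A : Matrix (Fin d) (Fin d) ℝ}
    {h K : ℝ} {x : EuclideanSpace ℝ (Fin d)} (hA : frobNorm A ≤ K * (1 + ‖x - minimizer F‖))
    (h0 : 0 ≤ h) (hLh : L * h ≤ 1 / 2) (hKh : 4 * L * K ^ 2 * h ≤ μ ^ 2) :
    ∫⁻ g : EuclideanSpace ℝ (Fin d), ENNReal.ofReal (F (x - h • ∇ F x + h • WithLp.toLp 2 (A.mulVec g)) - F (minimizer F))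
        ∂stdGaussian (EuclideanSpace ℝ (Fin d)) ≤
      ENNReal.ofReal ((1 - μ * h) * (F x - F (minimizer F)) + L * K ^ 2 * h ^ 2) := by
  refine (hF.lintegral_step_le hL A h x).trans (ENNReal.ofReal_le_ofReal ?_)
  have hμ := hF.mu_pos
  have hφ := sub_nonneg.2 (hF.minimizer_le x)
  have hpl := hF.polyak_lojasiewicz x
  have hq := hF.quadratic_growth x
  set φ := F x - F (minimizer F)
  set r := ‖x - minimizer F‖
  -- Since L h ≤ 1/2, the decrease is at least (3/2) μ h φ: one part μ h φ is kept, and the other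
  -- half part pays for the noise in `e4`.
  have e1 : h * (3 / 4) * (2 * μ * φ) ≤ h * (1 - L * h / 2) * ‖∇ F x‖ ^ 2 := by
    refine mul_le_mul ?_ hpl (by positivity) (mul_nonneg h0 (by linarith))
    gcongr
    linarith
  have e2 : frobNorm A ^ 2 ≤ K ^ 2 * (2 + 4 / μ * φ) := by
    calc frobNorm A ^ 2 ≤ (K * (1 + r)) ^ 2 := by
          gcongr
          exact Real.sqrt_nonneg _
      _ = K ^ 2 * (1 + r) ^ 2 := by ring
      _ ≤ K ^ 2 * (2 + 4 / μ * φ) := by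
          gcongr
          have : 4 / μ * φ = 2 * (2 / μ * φ) := by ring
          -- (1 + r)² ≤ 2 + 2 r², followed by quadratic growth.
          nlinarith [sq_nonneg (1 - r)]
  have e3 : L / 2 * h ^ 2 * frobNorm A ^ 2 ≤ L / 2 * h ^ 2 * (K ^ 2 * (2 + 4 / μ * φ)) := by
    gcongr
  have e4 : L / 2 * h ^ 2 * (K ^ 2 * (4 / μ * φ)) ≤ h * (μ / 2) * φ := by
    have : L / 2 * h ^ 2 * (K ^ 2 * (4 / μ * φ)) = h * (4 * L * K ^ 2 * h / (2 * μ)) * φ := by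
      field_simp
    rw [this]
    have hc : 4 * L * K ^ 2 * h / (2 * μ) ≤ μ / 2 := by
      rw [div_le_iff₀ (by positivity)]
      linarith
    gcongr
  linarith

/-! ### Measurability, independence and the recursion for the iterates -/

section scheme

variable {d : ℕ} {F : EuclideanSpace ℝ (Fin d) → ℝ} {μ : ℝ}
  {σ : ℝ → EuclideanSpace ℝ (Fin d) → Matrix (Fin d) (Fin d) ℝ}

theorem BasicDiffusion.continuous_apply {xs : EuclideanSpace ℝ (Fin d)}
    (hσ : BasicDiffusion σ xs) {t : ℝ} (ht : 0 ≤ t) : Continuous (σ t) :=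
  hσ.continuousOn.comp_continuous (f := fun x => (t, x)) (by fun_prop) fun x => ⟨ht, trivial⟩

theorem continuous_sgStep (hF : BasicObjective F μ) {xs : EuclideanSpace ℝ (Fin d)}
    (hσ : BasicDiffusion σ xs) {t : ℝ} (ht : 0 ≤ t) (h : ℝ) :
    Continuous fun p : EuclideanSpace ℝ (Fin d) × EuclideanSpace ℝ (Fin d) =>
      p.1 - h • ∇ F p.1 + h • WithLp.toLp 2 ((σ t p.1).mulVec p.2) := by
  have h1 := hF.continuous_gradient
  have h2 := hσ.continuous_apply ht
  have h3 : Continuous fun p : EuclideanSpace ℝ (Fin d) × EuclideanSpace ℝ (Fin d) =>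
      (σ t p.1).mulVec p.2 :=
    (h2.comp continuous_fst).matrix_mulVec (by fun_prop)
  fun_prop

/-- The `n`-th iterate is a measurable function of the first `n` noise vectors. -/
theorem exists_measurable_sgScheme_eq {Ω : Type*} (hF : BasicObjective F μ) {xs : EuclideanSpace ℝ (Fin d)}
    (hσ : BasicDiffusion σ xs) {h : ℝ} (h0 : 0 ≤ h) (x₀ : EuclideanSpace ℝ (Fin d)) (n : ℕ) :
    ∃ Φ : (Finset.range n → EuclideanSpace ℝ (Fin d)) → EuclideanSpace ℝ (Fin d),
      Measurable Φ ∧ ∀ (γ : ℕ → Ω → EuclideanSpace ℝ (Fin d)) (ω : Ω),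
        sgScheme F σ h x₀ γ n ω = Φ fun i => γ (i + 1) ω := by
  induction n with
  | zero => exact ⟨fun _ => x₀, measurable_const, fun _ _ => rfl⟩
  | succ n ih =>
    obtain ⟨Φ, hΦ, hΦe⟩ := ih
    refine ⟨fun u => (fun p : EuclideanSpace ℝ (Fin d) × EuclideanSpace ℝ (Fin d) =>
      p.1 - h • ∇ F p.1 + h • WithLp.toLp 2 ((σ (n * h) p.1).mulVec p.2))
      (Φ fun i => u ⟨i, Finset.range_subset_range.2 n.le_succ i.2⟩,
        u ⟨n, Finset.self_mem_range_succ n⟩), ?_, fun γ ω => ?_⟩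
    · refine (continuous_sgStep hF hσ (by positivity) h).measurable.comp ?_
      exact Measurable.prodMk (hΦ.comp (measurable_pi_lambda _ fun i => measurable_pi_apply
        (⟨i, Finset.range_subset_range.2 n.le_succ i.2⟩ : Finset.range (n + 1))))
        (measurable_pi_apply (⟨n, Finset.self_mem_range_succ n⟩ : Finset.range (n + 1)))
    · simp only [sgScheme, hΦe]

variable {Ω : Type*} [MeasurableSpace Ω] {P : Measure Ω}
  {γ : ℕ → Ω → EuclideanSpace ℝ (Fin d)}

theorem aemeasurable_sgScheme (hF : BasicObjective F μ) {xs : EuclideanSpace ℝ (Fin d)}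
    (hσ : BasicDiffusion σ xs) (hγ : IsGaussianNoise P γ) {h : ℝ} (h0 : 0 ≤ h)
    (x₀ : EuclideanSpace ℝ (Fin d)) (n : ℕ) : AEMeasurable (sgScheme F σ h x₀ γ n) P := by
  obtain ⟨Φ, hΦ, hΦe⟩ := exists_measurable_sgScheme_eq (Ω := Ω) hF hσ h0 x₀ n
  rw [show sgScheme F σ h x₀ γ n = Φ ∘ fun ω i => γ (i + 1) ω from funext (hΦe γ)]
  exact hΦ.comp_aemeasurable (aemeasurable_pi_lambda _ fun i => (hγ.hasLaw i).aemeasurable)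

theorem indepFun_sgScheme (hF : BasicObjective F μ) {xs : EuclideanSpace ℝ (Fin d)}
    (hσ : BasicDiffusion σ xs) (hγ : IsGaussianNoise P γ) {h : ℝ} (h0 : 0 ≤ h)
    (x₀ : EuclideanSpace ℝ (Fin d)) (n : ℕ) :
    IndepFun (sgScheme F σ h x₀ γ n) (γ (n + 1)) P := by
  obtain ⟨Φ, hΦ, hΦe⟩ := exists_measurable_sgScheme_eq (Ω := Ω) hF hσ h0 x₀ n
  have h1 := hγ.indep.indepFun_finset₀ (Finset.range n) {n} (by simp)
    fun i => (hγ.hasLaw i).aemeasurable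
  have h2 := h1.comp hΦ (measurable_pi_apply (⟨n, Finset.mem_singleton_self n⟩ : ({n} : Finset ℕ)))
  rwa [show sgScheme F σ h x₀ γ n = Φ ∘ fun ω i => γ (i + 1) ω from funext (hΦe γ)]

/-- By independence the joint law of the iterate and the next noise vector is a product, so Tonelli
allows averaging over the noise with the iterate frozen. -/
theorem lintegral_sgScheme_succ [IsProbabilityMeasure P] (hF : BasicObjective F μ)
    {xs : EuclideanSpace ℝ (Fin d)}
    (hσ : BasicDiffusion σ xs) (hγ : IsGaussianNoise P γ) {h : ℝ} (h0 : 0 ≤ h)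
    (x₀ : EuclideanSpace ℝ (Fin d)) (n : ℕ) :
    ∫⁻ ω, ENNReal.ofReal (F (sgScheme F σ h x₀ γ (n + 1) ω) - F (minimizer F)) ∂P =
      ∫⁻ ω, ∫⁻ g : EuclideanSpace ℝ (Fin d), ENNReal.ofReal (F (sgScheme F σ h x₀ γ n ω - h • ∇ F (sgScheme F σ h x₀ γ n ω)
        + h • WithLp.toLp 2 ((σ (n * h) (sgScheme F σ h x₀ γ n ω)).mulVec g)) - F (minimizer F))
        ∂stdGaussian (EuclideanSpace ℝ (Fin d)) ∂P := by
  have hX := aemeasurable_sgScheme hF hσ hγ h0 x₀ n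
  have hg := (hγ.hasLaw n).aemeasurable
  set G : EuclideanSpace ℝ (Fin d) × EuclideanSpace ℝ (Fin d) → ENNReal := fun p =>
    ENNReal.ofReal (F (p.1 - h • ∇ F p.1 + h • WithLp.toLp 2 ((σ (n * h) p.1).mulVec p.2))
      - F (minimizer F)) with hG
  have hGm : Measurable G := by
    have h1 := hF.contDiff.continuous.comp
      (continuous_sgStep hF hσ (t := n * h) (by positivity) h)
    exact (h1.sub continuous_const).measurable.ennreal_ofReal
  have hmap := (indepFun_sgScheme hF hσ hγ h0 x₀ n).map_prod_eq_prod_map_map hX hg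
  rw [(hγ.hasLaw n).map_eq] at hmap
  calc _ = ∫⁻ ω, G (sgScheme F σ h x₀ γ n ω, γ (n + 1) ω) ∂P := rfl
    _ = ∫⁻ p, G p ∂P.map (fun ω => (sgScheme F σ h x₀ γ n ω, γ (n + 1) ω)) :=
      (lintegral_map' hGm.aemeasurable (hX.prodMk hg)).symm
    _ = ∫⁻ x, ∫⁻ g, G (x, g) ∂stdGaussian (EuclideanSpace ℝ (Fin d))
          ∂P.map (sgScheme F σ h x₀ γ n) := by
      rw [hmap, lintegral_prod _ hGm.aemeasurable]
    _ = _ := lintegral_map' hGm.lintegral_prod_right'.aemeasurable hX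

/-- The constant L K² h / μ is the fixed point of a ↦ (1 - μh) a + L K² h², so it reproduces itself
in the induction. -/
theorem lintegral_sgScheme_le [IsProbabilityMeasure P] (hF : BasicObjective F μ)
    (hσ : BasicDiffusion σ (minimizer F)) (hγ : IsGaussianNoise P γ) {L K h : ℝ} (hL0 : 0 < L)
    (hL : ∀ x₁ x₂, ‖∇ F x₂ - ∇ F x₁‖ ≤ L * ‖x₂ - x₁‖)
    (hK : ∀ t, 0 ≤ t → ∀ x, frobNorm (σ t x) ≤ K * (1 + ‖x - minimizer F‖))
    (h0 : 0 < h) (hLh : L * h ≤ 1 / 2) (hKh : 4 * L * K ^ 2 * h ≤ μ ^ 2) (hμh : μ * h ≤ 1)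
    (x₀ : EuclideanSpace ℝ (Fin d)) (n : ℕ) :
    ∫⁻ ω, ENNReal.ofReal (F (sgScheme F σ h x₀ γ n ω) - F (minimizer F)) ∂P ≤
      ENNReal.ofReal ((1 - μ * h) ^ n * (F x₀ - F (minimizer F)) + L * K ^ 2 / μ * h) := by
  have hμ := hF.mu_pos
  induction n with
  | zero =>
    simp only [sgScheme, lintegral_const, measure_univ, mul_one, pow_zero, one_mul]
    exact ENNReal.ofReal_le_ofReal (le_add_of_nonneg_right (by positivity))
  | succ n ih =>
    have h1 : 0 ≤ 1 - μ * h := by linarith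
    rw [lintegral_sgScheme_succ hF hσ hγ h0.le]
    calc _ ≤ ∫⁻ ω, ENNReal.ofReal ((1 - μ * h) *
            (F (sgScheme F σ h x₀ γ n ω) - F (minimizer F)) + L * K ^ 2 * h ^ 2) ∂P :=
          lintegral_mono fun ω => hF.lintegral_step_le_contraction hL0 hL
            (hK _ (by positivity) _) h0.le hLh hKh
      _ = ∫⁻ ω, (ENNReal.ofReal (1 - μ * h) * ENNReal.ofReal
            (F (sgScheme F σ h x₀ γ n ω) - F (minimizer F))
              + ENNReal.ofReal (L * K ^ 2 * h ^ 2)) ∂P := by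
          refine lintegral_congr fun ω => ?_
          rw [ENNReal.ofReal_add (mul_nonneg h1 (sub_nonneg.2 (hF.minimizer_le _)))
            (by positivity), ENNReal.ofReal_mul h1]
      _ = ENNReal.ofReal (1 - μ * h) * (∫⁻ ω, ENNReal.ofReal
            (F (sgScheme F σ h x₀ γ n ω) - F (minimizer F)) ∂P)
              + ENNReal.ofReal (L * K ^ 2 * h ^ 2) := by
          rw [lintegral_add_right _ measurable_const, lintegral_const_mul' _ _ ENNReal.ofReal_ne_top]
          simp
      _ ≤ ENNReal.ofReal (1 - μ * h) * ENNReal.ofReal ((1 - μ * h) ^ n *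
            (F x₀ - F (minimizer F)) + L * K ^ 2 / μ * h)
              + ENNReal.ofReal (L * K ^ 2 * h ^ 2) := by gcongr
      _ = _ := by
          have h2 := sub_nonneg.2 (hF.minimizer_le x₀)
          rw [← ENNReal.ofReal_mul h1, ← ENNReal.ofReal_add (by positivity) (by positivity)]
          congr 1
          field_simp
          ring

end scheme

/-! ### Square roots and the final rates -/

theorem integral_le_sqrt_integral_sq {Ω : Type*} [MeasurableSpace Ω] {P : Measure Ω}
    [IsProbabilityMeasure P] {f : Ω → ℝ} (hf : MemLp f 2 P) :
    ∫ ω, f ω ∂P ≤ Real.sqrt (∫ ω, f ω ^ 2 ∂P) := by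
  refine Real.le_sqrt_of_sq_le ?_
  have h1 := variance_nonneg f P
  rw [variance_eq_sub hf] at h1
  simpa using h1

theorem sq_le_one_add_pow_three {r : ℝ} (hr : 0 ≤ r) : r ^ 2 ≤ 1 + r ^ 3 := by
  nlinarith [mul_nonneg hr (sq_nonneg (r - 1)), sq_nonneg (r - 1)]

theorem sqrt_add_le_add_sqrt {x y : ℝ} (hx : 0 ≤ x) (hy : 0 ≤ y) :
    Real.sqrt (x + y) ≤ Real.sqrt x + Real.sqrt y := by
  refine (Real.sqrt_le_iff).2 ⟨by positivity, ?_⟩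
  have h1 : 0 ≤ Real.sqrt x * Real.sqrt y := by positivity
  linarith [add_sq (Real.sqrt x) (Real.sqrt y), Real.sq_sqrt hx, Real.sq_sqrt hy]

theorem sqrt_rate_le {c r e h : ℝ} (hr : 0 ≤ r) (h0 : 0 ≤ h) :
    Real.sqrt (c * (1 + r ^ 3) * (Real.exp (-e) + h)) ≤
      Real.sqrt c * (1 + r ^ (3 / 2 : ℝ)) * (Real.exp (-(e / 2)) + Real.sqrt h) := by
  have h1 : Real.sqrt (r ^ 3) = r ^ (3 / 2 : ℝ) := by
    rw [Real.sqrt_eq_rpow, ← Real.rpow_natCast, ← Real.rpow_mul hr]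
    norm_num
  have h2 : Real.sqrt (Real.exp (-e)) = Real.exp (-(e / 2)) := by
    rw [← Real.exp_half]
    ring_nf
  rw [Real.sqrt_mul' _ (by positivity), Real.sqrt_mul' _ (by positivity), ← h1, ← h2]
  gcongr
  · simpa using sqrt_add_le_add_sqrt zero_le_one (pow_nonneg hr 3)
  · exact sqrt_add_le_add_sqrt (Real.exp_pos _).le h0

theorem corollary1 {d : ℕ} (F : EuclideanSpace ℝ (Fin d) → ℝ) (μ : ℝ)
    (hF : BasicObjective F μ)
    (σ : ℝ → EuclideanSpace ℝ (Fin d) → Matrix (Fin d) (Fin d) ℝ)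
    (hσ : BasicDiffusion σ (minimizer F)) (hmax : ℝ) (hmax_pos : 0 < hmax) :
    ∃ H C : ℝ, 0 < H ∧ H < hmax ∧ 0 < C ∧
      ∀ (Ω : Type*) [MeasurableSpace Ω] (P : Measure Ω) [IsProbabilityMeasure P]
        (γ : ℕ → Ω → EuclideanSpace ℝ (Fin d)), IsGaussianNoise P γ →
      ∀ (x₀ : EuclideanSpace ℝ (Fin d)) (N : ℕ) (h : ℝ), 1 ≤ N → 0 < h → h < H →
        Integrable (fun ω => F (sgScheme F σ h x₀ γ N ω) - F (minimizer F)) P ∧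
        MemLp (fun ω => sgScheme F σ h x₀ γ N ω - minimizer F) 2 P ∧
        ∫ ω, (F (sgScheme F σ h x₀ γ N ω) - F (minimizer F)) ∂P
          ≤ C * (1 + ‖x₀ - minimizer F‖ ^ 3) * (Real.exp (-(μ * N * h)) + h) ∧
        ∫ ω, ‖sgScheme F σ h x₀ γ N ω - minimizer F‖ ∂P
          ≤ Real.sqrt (∫ ω, ‖sgScheme F σ h x₀ γ N ω - minimizer F‖ ^ 2 ∂P) ∧
        Real.sqrt (∫ ω, ‖sgScheme F σ h x₀ γ N ω - minimizer F‖ ^ 2 ∂P)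
          ≤ C * (1 + ‖x₀ - minimizer F‖ ^ (3 / 2 : ℝ))
              * (Real.exp (-(μ * N * h / 2)) + Real.sqrt h) := by
  obtain ⟨L, hL0, hL⟩ := hF.lipschitz_gradient
  obtain ⟨ς, -, -, hgrowth, K₀, hK₀⟩ := hσ.lipschitz_growth
  have hμ := hF.mu_pos
  -- The maximum with 1 makes K positive, so that the step size threshold can be divided by K².
  set K : ℝ := max K₀ 1
  have hK1 : 0 < K := zero_lt_one.trans_le (le_max_right _ _)
  have hK : ∀ t, 0 ≤ t → ∀ x, frobNorm (σ t x) ≤ K * (1 + ‖x - minimizer F‖) := by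
    intro t ht x
    have h1 := (hgrowth t ht x).trans ((hK₀ t ht).trans (le_max_left K₀ 1))
    rwa [div_le_iff₀ (by positivity)] at h1
  -- L/2 comes from the initial excess, L K²/μ from the accumulated noise.
  set C₁ : ℝ := L / 2 + L * K ^ 2 / μ with hC₁
  have hC₁0 : 0 < C₁ := by positivity
  -- The value `hmax / 2` keeps H strictly below `hmax`; the other three entries are the step size
  -- conditions of the recursion. The constant is the sum of those needed for the two rates.
  refine ⟨min (hmax / 2) (min (1 / (2 * L)) (min (μ ^ 2 / (4 * L * K ^ 2)) (1 / μ))),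
    C₁ + Real.sqrt (2 / μ * C₁), by positivity,
    (min_le_left _ _).trans_lt (half_lt_self hmax_pos), by positivity, ?_⟩
  intro Ω _ P _ γ hγ x₀ N h _ h0 hH
  simp only [lt_min_iff] at hH
  obtain ⟨-, hH1, hH2, hH3⟩ := hH
  rw [lt_div_iff₀ (by positivity)] at hH1 hH2 hH3
  set r := ‖x₀ - minimizer F‖
  have hr : 0 ≤ r := norm_nonneg _
  set X := sgScheme F σ h x₀ γ N
  have hX : AEMeasurable X P := aemeasurable_sgScheme hF hσ hγ h0.le x₀ N
  have hφm : AEStronglyMeasurable (fun ω => F (X ω) - F (minimizer F)) P :=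
    ((hF.contDiff.continuous.measurable.comp_aemeasurable hX).sub
      aemeasurable_const).aestronglyMeasurable
  have hφ0 : ∀ ω, 0 ≤ F (X ω) - F (minimizer F) := fun ω => sub_nonneg.2 (hF.minimizer_le _)
  have hlint := lintegral_sgScheme_le hF hσ hγ hL0 hL hK h0 (by linarith) (by linarith)
    (by linarith) x₀ N
  -- The finite bound on the Lebesgue integral is what gives integrability.
  have hφi : Integrable (fun ω => F (X ω) - F (minimizer F)) P :=
    (lintegral_ofReal_ne_top_iff_integrable hφm (Filter.Eventually.of_forall hφ0)).1
      (ne_top_of_le_ne_top ENNReal.ofReal_ne_top hlint)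
  have hx₀ := sub_nonneg.2 (hF.minimizer_le x₀)
  have hμh : 0 ≤ 1 - μ * h := by linarith
  have hrate : ∫ ω, (F (X ω) - F (minimizer F)) ∂P
      ≤ C₁ * (1 + r ^ 3) * (Real.exp (-(μ * N * h)) + h) := by
    rw [← ofReal_integral_eq_lintegral_ofReal hφi (Filter.Eventually.of_forall hφ0),
      ENNReal.ofReal_le_ofReal_iff (by positivity)] at hlint
    have h1 : (1 - μ * h) ^ N ≤ Real.exp (-(μ * N * h)) := by
      calc (1 - μ * h) ^ N ≤ Real.exp (-(μ * h)) ^ N := by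
            gcongr
            exact Real.one_sub_le_exp_neg _
        _ = _ := by
            rw [← Real.exp_nat_mul]
            ring_nf
    have h2 : F x₀ - F (minimizer F) ≤ L / 2 * (1 + r ^ 3) :=
      (hF.sub_le_quadratic hL x₀).trans (by gcongr; exact sq_le_one_add_pow_three hr)
    calc _ ≤ _ := hlint
      _ ≤ Real.exp (-(μ * N * h)) * (L / 2 * (1 + r ^ 3)) + L * K ^ 2 / μ * h * (1 + r ^ 3) := by
          refine add_le_add (mul_le_mul h1 h2 hx₀ (Real.exp_pos _).le) ?_
          exact le_mul_of_one_le_right (by positivity)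
            (le_add_of_nonneg_right (pow_nonneg hr 3))
      _ ≤ _ := by
          have h3 : 0 ≤ L / 2 * h * (1 + r ^ 3) := by positivity
          have h4 : 0 ≤ L * K ^ 2 / μ * Real.exp (-(μ * N * h)) * (1 + r ^ 3) := by positivity
          rw [hC₁]
          linarith
  have hXs : AEStronglyMeasurable (fun ω => X ω - minimizer F) P :=
    (hX.sub aemeasurable_const).aestronglyMeasurable
  have hsq : Integrable (fun ω => ‖X ω - minimizer F‖ ^ 2) P := by
    refine (hφi.const_mul (2 / μ)).mono' (hXs.norm.pow 2) (Filter.Eventually.of_forall fun ω => ?_)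
    rw [Real.norm_of_nonneg (by positivity)]
    exact hF.quadratic_growth _
  have hmem : MemLp (fun ω => X ω - minimizer F) 2 P :=
    (memLp_two_iff_integrable_sq_norm hXs).2 hsq
  refine ⟨hφi, hmem, hrate.trans ?_, integral_le_sqrt_integral_sq hmem.norm, ?_⟩
  · gcongr
    exact le_add_of_nonneg_right (Real.sqrt_nonneg _)
  · have h1 : ∫ ω, ‖X ω - minimizer F‖ ^ 2 ∂P
        ≤ 2 / μ * C₁ * (1 + r ^ 3) * (Real.exp (-(μ * N * h)) + h) := by
      calc _ ≤ ∫ ω, 2 / μ * (F (X ω) - F (minimizer F)) ∂P :=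
            integral_mono hsq (hφi.const_mul _) fun ω => hF.quadratic_growth _
        _ ≤ 2 / μ * (C₁ * (1 + r ^ 3) * (Real.exp (-(μ * N * h)) + h)) := by
            rw [integral_const_mul]
            gcongr
        _ = _ := by ring
    refine (Real.sqrt_le_sqrt h1).trans ((sqrt_rate_le hr h0.le).trans ?_)
    gcongr
    exact le_add_of_nonneg_left hC₁0.le
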